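/- Theorem 2.1. Let $a,b,k,l,\bar b_1,\bar b_2>0$, let $A=\begin{pmatrix}-a&k\\ l&-b\end{pmatrix}$, and assume $\det A=ab-kl>0$. For $\tau>0$ consider Hill's delayed Richardson system $$x'(t)=k\,y(t-\tau)-a\,x(t-\tau)+\bar b_1,\qquad y'(t)=l\,x(t-\tau)-b\,y(t-\tau)+\bar b_2 .$$ It has a unique equilibrium $P_0=-A^{-1}(\bar b_1,\bar b_2)^T$, and both components of $P_0$ are positive. An equilibrium $P$ is called exponentially asymptotically stable if there are $\delta,K,\alpha>0$ such that every solution $X$ on $[-\tau,\infty)$ with continuous initial function $\varphi:[-\tau,0]\to\mathbb R^2$, $\|\varphi-P\|_\infty<\delta$, satisfies $|X(t)-P|\le Ke^{-\alpha t}\|\varphi-P\|_\infty$ for all $t\ge 0$. (i) For every $\tau>0$, $P_0$ is exponentially asymptotically stable if and only if $\tau<\tau_-$, where $$\tau_-=\frac{\pi}{4\det A}\Big[(a+b)-\sqrt{(a+b)^2-4\det A}\Big].$$ (ii) After the time rescaling $t\mapsto\tau t$ the linearization $X'(t)=AX(t-\tau)$ at $P_0$ becomes $X'(t)=\tau AX(t-1)$,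 with characteristic equation $$h(\lambda,\tau)=\det\big(\lambda I-\tau e^{-\lambda}A\big)=\lambda^2+\tau(a+b)\lambda e^{-\lambda}+\tau^2\det A\,e^{-2\lambda}=0 .$$ For $\tau>0$ and $\sigma>0$, $\pm i\sigma$ are roots of this equation if and only if, for some $n\in\{0,1,2,\dots\}$, $\sigma=\sigma_n$ and $\tau\in\{\tau_n^+,\tau_n^-\}$, where $$\sigma_n=\frac{\pi}{2}+2n\pi,\qquad \tau_n^{\pm}=\sigma_n\,\frac{(a+b)\pm\sqrt{(a+b)^2-4\det A}}{2\det A}.$$ (iii) For every $n\ge 0$, for each $\tau_0\in\{\tau_n^+,\tau_n^-\}$ and for each of the two roots $\lambda_0=\pm i\sigma_n$, the root crosses the imaginary axis transversally to the right as $\tau$ increases through $\tau_0$: in a neighbourhood of $(\lambda_0,\tau_0)$ the solutions $(\lambda,\tau)\in\mathbb C\times\mathbb R$ of $h(\lambda,\tau)=0$ form exactly one smooth curve $\tau\mapsto\lambda(\tau)$, and $\lambda(\tau_0)=\lambda_0$, $\operatorname{Re}\lambda'(\tau_0)>0$. -/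

import Mathlib

open scoped ContDiff Matrix

noncomputable section

namespace Richardson

/-- The matrix `A = [[-a, k], [l, -b]]` of the arms race model. -/
def armsMatrix (a b k l : ℝ) : Matrix (Fin 2) (Fin 2) ℝ := !![-a, k; l, -b]

/-- The right-hand side of Hill's delayed Richardson system: with `u = (x(t - τ), y(t - τ))`, it is
`(k u₂ - a u₁ + β₁, l u₁ - b u₂ + β₂)`. -/
def hillField (a b k l β₁ β₂ : ℝ) (u : Fin 2 → ℝ) : Fin 2 → ℝ :=
  ![k * u 1 - a * u 0 + β₁, l * u 0 - b * u 1 + β₂]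

/-- `X` is a solution on `[-τ, ∞)` of the autonomous delay equation `X'(t) = F (X (t - τ))`, `t ≥ 0`,
with initial function `φ ∈ C([-τ, 0]; ℝ²)` (the derivative at `t = 0` is the right derivative). -/
structure IsSolution (F : (Fin 2 → ℝ) → (Fin 2 → ℝ)) (τ : ℝ)
    (φ : C(Set.Icc (-τ) 0, Fin 2 → ℝ)) (X : ℝ → Fin 2 → ℝ) : Prop where
  continuousOn : ContinuousOn X (Set.Ici (-τ))
  initial : ∀ θ : Set.Icc (-τ) 0, X θ = φ θ
  equation : ∀ t, 0 ≤ t → HasDerivWithinAt X (F (X (t - τ))) (Set.Ici 0) t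

/-- `P` is an equilibrium of `X'(t) = F (X (t - τ))`. -/
def IsEquilibrium (F : (Fin 2 → ℝ) → (Fin 2 → ℝ)) (P : Fin 2 → ℝ) : Prop := F P = 0

/-- Exponential asymptotic stability of the equilibrium `P` of `X'(t) = F (X (t - τ))`: solutions
starting close to `P` approach `P` exponentially fast, at a uniform rate. The norm on initial
functions is the supremum norm. -/
def IsEAS (F : (Fin 2 → ℝ) → (Fin 2 → ℝ)) (τ : ℝ) (P : Fin 2 → ℝ) : Prop :=
  IsEquilibrium F P ∧
  ∃ δ > 0, ∃ K > 0, ∃ α > 0, ∀ φ : C(Set.Icc (-τ) 0, Fin 2 → ℝ),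
    ‖φ - ContinuousMap.const _ P‖ < δ → ∀ X, IsSolution F τ φ X →
      ∀ t, 0 ≤ t → ‖X t - P‖ ≤ K * Real.exp (-α * t) * ‖φ - ContinuousMap.const _ P‖

/-- The characteristic function `z ↦ det (z I - e^{-z r} B)` of the linear delay equation
`X'(t) = B X (t - r)`. -/
def charFun (B : Matrix (Fin 2) (Fin 2) ℝ) (r : ℝ) (z : ℂ) : ℂ :=
  (z • (1 : Matrix (Fin 2) (Fin 2) ℂ) - Complex.exp (-z * r) • B.map Complex.ofReal).det

/-- The characteristic function of `X'(t) = τ A X(t - 1)`, which is `X'(t) = A X(t - τ)` after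
rescaling time by `t ↦ τ t`, so that the delay `τ` becomes a parameter. -/
def scaledChar (A : Matrix (Fin 2) (Fin 2) ℝ) (z : ℂ) (τ : ℝ) : ℂ := charFun (τ • A) 1 z

/-- As the real parameter `τ` increases through `τ₀`, a root of `h(·, τ) = 0` crosses the imaginary
axis at `z₀` transversally, from left to right: near `(z₀, τ₀)` the roots form exactly one smooth
curve `τ ↦ c τ`, with `c τ₀ = z₀` on the imaginary axis and `Re c'(τ₀) > 0`. -/
def CrossesToRight (h : ℂ → ℝ → ℂ) (z₀ : ℂ) (τ₀ : ℝ) : Prop :=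
  z₀.re = 0 ∧
  ∃ ε > 0, ∃ δ > 0, ∃ c : ℝ → ℂ,
    ContDiffOn ℝ ∞ c (Set.Ioo (τ₀ - ε) (τ₀ + ε)) ∧
    c τ₀ = z₀ ∧
    (∀ τ ∈ Set.Ioo (τ₀ - ε) (τ₀ + ε), c τ ∈ Metric.ball z₀ δ ∧
      ∀ z ∈ Metric.ball z₀ δ, (h z τ = 0 ↔ z = c τ)) ∧
    0 < (deriv c τ₀).re

/-- The threshold `τ₋ = π / (4 det A) · [(a + b) - √((a + b)² - 4 det A)]`. -/
def tauThreshold (a b k l : ℝ) : ℝ :=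
  Real.pi / (4 * (armsMatrix a b k l).det) *
    ((a + b) - Real.sqrt ((a + b) ^ 2 - 4 * (armsMatrix a b k l).det))

/-- The frequencies `σ_n = π/2 + 2 n π`. -/
def sigmaN (n : ℕ) : ℝ := Real.pi / 2 + 2 * n * Real.pi

/-- The delays `τ_n⁺`. -/
def tauPlus (a b k l : ℝ) (n : ℕ) : ℝ :=
  sigmaN n * (((a + b) + Real.sqrt ((a + b) ^ 2 - 4 * (armsMatrix a b k l).det)) /
    (2 * (armsMatrix a b k l).det))

/-- The delays `τ_n⁻`. -/
def tauMinus (a b k l : ℝ) (n : ℕ) : ℝ :=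
  sigmaN n * (((a + b) - Real.sqrt ((a + b) ^ 2 - 4 * (armsMatrix a b k l).det)) /
    (2 * (armsMatrix a b k l).det))

end Richardson

end

namespace Richardson

open Set Filter Topology


/-! The matrix `A` has real, distinct, negative eigenvalues `-p`, `-q` with `0 < p < q`, because its
discriminant is `(a - b)² + 4kl > 0`. Everything therefore reduces to the scalar equation `u'(t) =
-c u(t - τ)` with `c = p` or `c = q`, and to the critical value `c τ = π/2`. The larger rate `q`
reaches it first, which gives the threshold `π / (2q)`.

Below the critical value, the operator advancing a history by one delay has no spectrum outside the
open unit disc (`cexp_neg_div_ne`, `eq_zero_of_smul_eq_stepOp`, `surjective_sub_stepOp`), so its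
powers decay geometrically. The two left eigenvectors of `A` carry this decay to the plane. At or
above it, `w e^w = -κ` has a root with `Re w ≥ 0`, and the corresponding scalar solution along an
eigenvector violates every exponential bound.

The characteristic function splits as `(z + τ p e^{-z})(z + τ q e^{-z})`. Imaginary roots are found
factor by factor. Near such a root the vanishing factor reads `z e^z = -τ p` (or `-τ q`), and the
inverse function theorem yields the branch and its derivative. -/

/-! ### Scalar delay equation: spectrum of the one-delay operator and decay. -/

/-- The solution operator over one delay of `x'(t) = -κ x(t - 1)`, acting on histories
parametrised by `[0, 1]`. -/
noncomputable def stepLinear (κ : ℂ) : C(Icc (0 : ℝ) 1, ℂ) →ₗ[ℂ] C(Icc (0 : ℝ) 1, ℂ) where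
  toFun φ :=
    { toFun := fun s => φ 1 - κ * ∫ r in (0 : ℝ)..s, IccExtend zero_le_one φ r
      continuous_toFun := by
        have h : Continuous (IccExtend (zero_le_one' ℝ) φ) := φ.continuous.Icc_extend'
        have h' := intervalIntegral.continuous_primitive (μ := MeasureTheory.volume)
          (fun a b => h.intervalIntegrable a b) 0
        exact continuous_const.sub (continuous_const.mul (h'.comp continuous_subtype_val)) }
  map_add' φ ψ := by
    ext s
    have h (χ : C(Icc (0 : ℝ) 1, ℂ)) : Continuous (IccExtend (zero_le_one' ℝ) χ) :=
      χ.continuous.Icc_extend'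
    have := intervalIntegral.integral_add (μ := MeasureTheory.volume)
      ((h φ).intervalIntegrable 0 s) ((h ψ).intervalIntegrable 0 s)
    simp only [IccExtend, Function.comp_apply, ContinuousMap.add_apply, ContinuousMap.coe_mk]
      at this ⊢
    rw [this]
    ring
  map_smul' c φ := by
    ext s
    simp only [IccExtend, Function.comp_apply, ContinuousMap.smul_apply, ContinuousMap.coe_mk,
      smul_eq_mul, intervalIntegral.integral_const_mul, RingHom.id_apply]
    ring

/-- `stepLinear` as a bounded operator. -/
noncomputable def stepOp (κ : ℂ) : C(Icc (0 : ℝ) 1, ℂ) →L[ℂ] C(Icc (0 : ℝ) 1, ℂ) :=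
  (stepLinear κ).mkContinuous (1 + ‖κ‖) fun φ => by
    rw [ContinuousMap.norm_le _ (by positivity)]
    intro s
    have h1 : ‖∫ r in (0 : ℝ)..s, IccExtend (zero_le_one' ℝ) φ r‖ ≤ ‖φ‖ * |(s : ℝ) - 0| :=
      intervalIntegral.norm_integral_le_of_norm_le_const fun r _ => φ.norm_coe_le_norm _
    have h2 : |(s : ℝ) - 0| ≤ 1 := by
      rw [sub_zero, abs_of_nonneg s.2.1]; exact s.2.2
    calc ‖φ 1 - κ * ∫ r in (0 : ℝ)..s, IccExtend zero_le_one φ r‖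
        ≤ ‖φ 1‖ + ‖κ‖ * ‖∫ r in (0 : ℝ)..s, IccExtend (zero_le_one' ℝ) φ r‖ := by
          rw [← norm_mul]; exact norm_sub_le _ _
      _ ≤ ‖φ‖ + ‖κ‖ * (‖φ‖ * 1) := by
          gcongr
          · exact φ.norm_coe_le_norm _
          · exact h1.trans (by gcongr)
      _ = (1 + ‖κ‖) * ‖φ‖ := by ring

theorem stepOp_apply (κ : ℂ) (φ : C(Icc (0 : ℝ) 1, ℂ)) (s : Icc (0 : ℝ) 1) :
    stepOp κ φ s = φ 1 - κ * ∫ r in (0 : ℝ)..s, IccExtend zero_le_one φ r := rfl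

/-- Evaluation of the step operator at a history given by a function on the line with a known
primitive. -/
theorem stepOp_apply_of_hasDerivAt (κ : ℂ) {f G : ℝ → ℂ} (hf : Continuous f)
    (hG : ∀ s, HasDerivAt G (f s) s) (s : Icc (0 : ℝ) 1) :
    stepOp κ ⟨fun s => f s, hf.comp continuous_subtype_val⟩ s = f 1 - κ * (G s - G 0) := by
  rw [stepOp_apply, ← intervalIntegral.integral_eq_sub_of_hasDerivAt (fun x _ => hG x)
    (hf.intervalIntegrable 0 s)]
  congr 2
  refine intervalIntegral.integral_congr fun r hr => ?_
  rw [uIcc_of_le s.2.1] at hr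
  exact IccExtend_of_mem _ _ ⟨hr.1, hr.2.trans s.2.2⟩

theorem hasDerivAt_cexp_real (q : ℂ) (s : ℝ) :
    HasDerivAt (fun s : ℝ => Complex.exp (q * s)) (q * Complex.exp (q * s)) s := by
  have h : HasDerivAt (fun s : ℝ => q * (s : ℂ)) (q * 1) s :=
    (Complex.ofRealCLM.hasDerivAt (x := s)).const_mul q
  simpa [mul_comm] using h.cexp

/-- An eigenfunction satisfies `μ φ' = -κ φ` and `μ φ(0) = φ(1)`; the first makes it a multiple of
`e^{-κ s / μ}`, and the second then forces `e^{-κ/μ} = μ` unless it vanishes. -/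
theorem eq_zero_of_smul_eq_stepOp {κ μ : ℂ} (hμ : μ ≠ 0) (h : Complex.exp (-(κ / μ)) ≠ μ)
    {φ : C(Icc (0 : ℝ) 1, ℂ)} (hφ : μ • φ = stepOp κ φ) : φ = 0 := by
  have hφ' (s : Icc (0 : ℝ) 1) :
      μ * φ s = φ 1 - κ * ∫ r in (0 : ℝ)..s, IccExtend zero_le_one φ r :=
    DFunLike.congr_fun hφ s
  have hc : Continuous (IccExtend (zero_le_one' ℝ) φ) := φ.continuous.Icc_extend'
  set G : ℝ → ℂ := fun s => ∫ r in (0 : ℝ)..s, IccExtend zero_le_one φ r with hGdef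
  have hG (s : ℝ) : HasDerivAt G (IccExtend (zero_le_one' ℝ) φ s) s :=
    intervalIntegral.integral_hasDerivAt_right (hc.intervalIntegrable _ _)
      (hc.stronglyMeasurableAtFilter _ _) hc.continuousAt
  have hφG (s : ℝ) (hs : s ∈ Icc (0 : ℝ) 1) : μ * φ ⟨s, hs⟩ = φ 1 - κ * G s := hφ' ⟨s, hs⟩
  -- On `[0, 1]` this is `e^{κ s / μ} μ φ(s)`; writing it through `G` makes it differentiable.
  set H : ℝ → ℂ := fun s => Complex.exp (κ / μ * s) * (φ 1 - κ * G s) with hHdef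
  have hH (s : ℝ) : HasDerivAt H (κ / μ * Complex.exp (κ / μ * s) * (φ 1 - κ * G s) +
      Complex.exp (κ / μ * s) * (-(κ * IccExtend (zero_le_one' ℝ) φ s))) s :=
    (hasDerivAt_cexp_real _ s).mul (((hG s).const_mul κ).const_sub _)
  have hG0 : G 0 = 0 := by simp [hGdef]
  have hconst (s : ℝ) (hs : s ∈ Icc (0 : ℝ) 1) : H s = φ 1 := by
    have h0 : H 0 = φ 1 := by simp [hHdef, hG0]
    rw [← h0]
    refine constant_of_has_deriv_right_zero
      (fun s _ => (hH s).continuousAt.continuousWithinAt) (fun s hs => ?_) s hs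
    have hs' : s ∈ Icc (0 : ℝ) 1 := ⟨hs.1, hs.2.le⟩
    refine (hH s).hasDerivWithinAt.congr_deriv ?_
    rw [IccExtend_of_mem _ _ hs', ← hφG s hs']
    field_simp
    ring
  have hφ1 : φ 1 = 0 := by
    by_contra hne
    have h1 := hconst 1 ⟨zero_le_one, le_rfl⟩
    simp only [hHdef, ← hφG 1 ⟨zero_le_one, le_rfl⟩] at h1
    apply h
    rw [Complex.exp_neg, inv_eq_iff_eq_inv]
    have : Complex.exp (κ / μ) * μ * φ 1 = 1 * φ 1 := by
      rw [mul_assoc, one_mul]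
      rw [Complex.ofReal_one, mul_one] at h1
      exact h1
    exact eq_inv_of_mul_eq_one_left (mul_right_cancel₀ hne this)
  ext s
  have h2 := hconst s s.2
  simp only [hHdef, ← hφG s s.2] at h2
  simpa [hμ, hφ1] using h2

/-- Variation of constants solves the resolvent equation up to the constant `χ 1`. A multiple of
`η`, whose image is the constant `1 - e^{-q}/μ ≠ 0`, removes that defect. -/
theorem surjective_sub_stepOp {κ μ : ℂ} (hμ : μ ≠ 0) (h : Complex.exp (-(κ / μ)) ≠ μ) :
    Function.Surjective fun φ => μ • φ - stepOp κ φ := by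
  intro ψ
  set q := κ / μ with hq
  have hψ : Continuous (IccExtend (zero_le_one' ℝ) ψ) := ψ.continuous.Icc_extend'
  -- the homogeneous direction
  obtain ⟨η, hη⟩ : ∃ η, ∀ s, μ * η s - stepOp κ η s = 1 - Complex.exp (-q) / μ := by
    have hc : Continuous fun s : ℝ => -q * Complex.exp (-q * s) := by fun_prop
    by_cases hκ : κ = 0
    · refine ⟨ContinuousMap.const _ μ⁻¹, fun s => ?_⟩
      simp [hq, hκ, stepOp_apply, hμ]
    -- This is `e^{-q s} / μ`, written as a multiple of a derivative so that its primitive is at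
    -- hand.
    · refine ⟨(-κ)⁻¹ • ⟨fun s => -q * Complex.exp (-q * (s : ℝ)),
        hc.comp continuous_subtype_val⟩, fun s => ?_⟩
      have := stepOp_apply_of_hasDerivAt κ hc (hasDerivAt_cexp_real (-q)) s
      rw [map_smul, ContinuousMap.smul_apply, ContinuousMap.smul_apply, this]
      simp only [ContinuousMap.coe_mk, smul_eq_mul]
      simp only [Complex.ofReal_one, Complex.ofReal_zero, mul_zero, mul_one, Complex.exp_zero, hq]
      field_simp
      ring
  -- a particular solution up to a constant
  obtain ⟨χ, hχ⟩ : ∃ χ, ∀ s, μ * χ s - stepOp κ χ s = ψ s - χ 1 := by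
    have hc : Continuous fun r : ℝ => Complex.exp (q * r) * (IccExtend zero_le_one ψ r / μ) := by
      fun_prop
    set P : ℝ → ℂ := fun s => ∫ r in (0 : ℝ)..s, Complex.exp (q * r) * (IccExtend zero_le_one ψ r / μ)
      with hP
    have hPd (s : ℝ) : HasDerivAt P (Complex.exp (q * s) * (IccExtend zero_le_one ψ s / μ)) s :=
      intervalIntegral.integral_hasDerivAt_right (hc.intervalIntegrable _ _)
        (hc.stronglyMeasurableAtFilter _ _) hc.continuousAt
    have hPc : Continuous P := continuous_iff_continuousAt.2 fun s => (hPd s).continuousAt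
    -- With `v = e^{-q s} P`, the solution of `v' + q v = ψ / μ`, `v(0) = 0`, this is `v'`.
    set f : ℝ → ℂ := fun s => IccExtend zero_le_one ψ s / μ - q * (Complex.exp (-q * s) * P s)
      with hf
    have hfc : Continuous f := by fun_prop
    have hGd (s : ℝ) : HasDerivAt (fun s : ℝ => Complex.exp (-q * s) * P s) (f s) s := by
      refine ((hasDerivAt_cexp_real (-q) s).mul (hPd s)).congr_deriv ?_
      rw [← mul_assoc (Complex.exp (-q * s)) (Complex.exp (q * s)), ← Complex.exp_add]
      simp [hf]
      ring
    refine ⟨⟨fun s => f s, hfc.comp continuous_subtype_val⟩, fun s => ?_⟩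
    rw [stepOp_apply_of_hasDerivAt κ hfc hGd s]
    have hP0 : P 0 = 0 := by simp [hP]
    simp only [ContinuousMap.coe_mk, hP0, mul_zero, sub_zero]
    have : μ * f s = ψ s - κ * (Complex.exp (-q * s) * P s) := by
      simp only [hf, IccExtend_val]
      rw [hq]; field_simp
    rw [this]
    simp
  have hne : 1 - Complex.exp (-q) / μ ≠ 0 := by
    rw [sub_ne_zero, ne_comm, Ne, div_eq_one_iff_eq hμ]; exact h
  refine ⟨χ + (χ 1 / (1 - Complex.exp (-q) / μ)) • η, ?_⟩
  ext s
  simp only [map_add, map_smul, ContinuousMap.add_apply, ContinuousMap.sub_apply,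
    ContinuousMap.smul_apply, smul_eq_mul]
  linear_combination hχ s + χ 1 / (1 - Complex.exp (-q) / μ) * hη s + div_mul_cancel₀ (χ 1) hne

/-- If `μ = e^w` with `w = -κ/μ`, then `|μ| ≥ 1` gives `Re w ≥ 0` and `|Im w| ≤ κ < π/2`. But `w =
-κ e^{-w}` then has negative real part. -/
theorem cexp_neg_div_ne {κ : ℝ} (hκ : 0 < κ) (hκ' : κ < Real.pi / 2) {μ : ℂ} (hμ : 1 ≤ ‖μ‖) :
    Complex.exp (-(κ / μ)) ≠ μ := by
  intro h
  have hμ0 : μ ≠ 0 := by rintro rfl; norm_num at hμ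
  set w : ℂ := -(κ / μ) with hw
  have hnorm : ‖w‖ ≤ κ := by
    rw [hw, norm_neg, norm_div, Complex.norm_of_nonneg hκ.le]
    exact div_le_self hκ.le hμ
  have hre : 0 ≤ w.re := by
    rw [← h, Complex.norm_exp] at hμ
    exact Real.one_le_exp_iff.1 hμ
  have him : |w.im| < Real.pi / 2 := (Complex.abs_im_le_norm w).trans_lt (hnorm.trans_lt hκ')
  have hcos : 0 < Real.cos w.im := Real.cos_pos_of_mem_Ioo ⟨by linarith [neg_abs_le w.im],
    by linarith [le_abs_self w.im]⟩
  have heq : w = -(κ * Complex.exp (-w)) := by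
    rw [Complex.exp_neg, h, hw, div_eq_mul_inv]
  have hre' : w.re = -(κ * (Real.exp (-w.re) * Real.cos w.im)) := by
    conv_lhs => rw [heq]
    simp [Complex.exp_re]
  have : 0 < κ * (Real.exp (-w.re) * Real.cos w.im) := by positivity
  linarith

/-- Powers of an element of spectral radius below one decay geometrically. -/
theorem exists_norm_pow_le_of_spectralRadius_lt_one {B : Type*} [NormedRing B] [NormedAlgebra ℂ B]
    [CompleteSpace B] {T : B} (h : spectralRadius ℂ T < 1) :
    ∃ C > 0, ∃ r : ℝ, 0 < r ∧ r < 1 ∧ ∀ n : ℕ, ‖T ^ n‖ ≤ C * r ^ n := by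
  obtain ⟨r, hr, hr1⟩ := ENNReal.lt_iff_exists_nnreal_btwn.1 h
  have hr0 : 0 < r := by
    rw [← ENNReal.coe_pos]
    exact (zero_le).trans_lt hr
  -- Gelfand's formula: `‖T ^ n‖ ≤ r ^ n` eventually, and `C` absorbs the finitely many other
  -- powers.
  have hev := (spectrum.pow_nnnorm_pow_one_div_tendsto_nhds_spectralRadius T).eventually_lt_const hr
  have hb : ∀ᶠ n : ℕ in atTop, ‖T ^ n‖ / (r : ℝ) ^ n ≤ 1 := by
    filter_upwards [hev, eventually_gt_atTop 0] with n hn hn0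
    rw [div_le_one (by positivity)]
    have hn0' : (0 : ℝ) < n := by exact_mod_cast hn0
    rw [one_div, ENNReal.rpow_inv_lt_iff hn0', ENNReal.rpow_natCast] at hn
    exact_mod_cast hn.le
  obtain ⟨C, hC⟩ := (isBoundedUnder_of_eventually_le hb).bddAbove_range
  refine ⟨max C 1, by positivity, r, by exact_mod_cast hr0, by exact_mod_cast hr1, fun n => ?_⟩
  rw [← div_le_iff₀ (by positivity)]
  exact (hC (mem_range_self n)).trans (le_max_left _ _)

/-- If `z - T` is bijective for all `z` outside the open unit disc, the powers of `T` decay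
geometrically. -/
theorem exists_norm_pow_le_of_bijective {E : Type*} [NormedAddCommGroup E] [NormedSpace ℂ E]
    [CompleteSpace E] [Nontrivial E] {T : E →L[ℂ] E}
    (h : ∀ z : ℂ, 1 ≤ ‖z‖ → Function.Bijective fun x => z • x - T x) :
    ∃ C > 0, ∃ r : ℝ, 0 < r ∧ r < 1 ∧ ∀ n : ℕ, ‖T ^ n‖ ≤ C * r ^ n := by
  refine exists_norm_pow_le_of_spectralRadius_lt_one
    (spectrum.spectralRadius_lt_of_forall_lt (r := 1) _ fun z hz => ?_)
  by_contra hlt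
  exact hz (ContinuousLinearMap.isUnit_iff_bijective.2 (h z (by exact_mod_cast not_lt.1 hlt)))

theorem exists_norm_stepOp_pow_le {κ : ℝ} (hκ : 0 < κ) (hκ' : κ < Real.pi / 2) :
    ∃ C > 0, ∃ r : ℝ, 0 < r ∧ r < 1 ∧ ∀ n : ℕ, ‖stepOp κ ^ n‖ ≤ C * r ^ n := by
  refine exists_norm_pow_le_of_bijective fun z hz => ?_
  have hz0 : z ≠ 0 := by rintro rfl; norm_num at hz
  have h := cexp_neg_div_ne hκ hκ' hz
  refine ⟨fun φ ψ hφψ => sub_eq_zero.1 (eq_zero_of_smul_eq_stepOp hz0 h ?_),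
    surjective_sub_stepOp hz0 h⟩
  rw [smul_sub, map_sub]
  exact sub_eq_sub_iff_sub_eq_sub.1 hφψ

/-- Solutions of `u'(t) = -c u(t - τ)` decay exponentially when `c τ < π / 2`. -/
theorem exists_scalar_decay {c τ : ℝ} (hc : 0 < c) (hτ : 0 < τ) (h : c * τ < Real.pi / 2) :
    ∃ K > 0, ∃ α > 0, ∀ (u : ℝ → ℝ) (M : ℝ), ContinuousOn u (Ici (-τ)) →
      (∀ t, 0 ≤ t → HasDerivWithinAt u (-c * u (t - τ)) (Ici 0) t) →
      (∀ t ∈ Icc (-τ) 0, |u t| ≤ M) → ∀ t, 0 ≤ t → |u t| ≤ K * Real.exp (-α * t) * M := by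
  obtain ⟨C, hC, r, hr0, hr1, hpow⟩ := exists_norm_stepOp_pow_le (mul_pos hc hτ) h
  -- This rate makes `e^{-α t} = r^{t/τ}`.
  refine ⟨C, hC, -Real.log r / τ, div_pos (neg_pos.2 (Real.log_neg hr0 hr1)) hτ, ?_⟩
  intro u M hu hd hM t ht
  have hM0 : 0 ≤ M := (abs_nonneg _).trans (hM 0 ⟨by linarith, le_rfl⟩)
  have hseg (n : ℕ) : Continuous fun s : Icc (0 : ℝ) 1 => (u (-τ + (n + s) * τ) : ℂ) := by
    refine Complex.continuous_ofReal.comp (hu.comp_continuous (by fun_prop) fun s => ?_)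
    have := s.2.1
    have : 0 ≤ (n + (s : ℝ)) * τ := by positivity
    simpa using this
  have hstep (n : ℕ) : (⟨_, hseg (n + 1)⟩ : C(Icc (0 : ℝ) 1, ℂ)) =
      stepOp ((c * τ : ℝ) : ℂ) ⟨_, hseg n⟩ := by
    ext s
    have hs0 := s.2.1
    have hint : ∫ r in (0 : ℝ)..s, (-(c * τ) * u (-τ + (n + r) * τ) : ℝ) =
        u ((n + s) * τ) - u ((n + 0) * τ) := by
      have hmaps : MapsTo (fun r : ℝ => (n + r) * τ) (Icc 0 (s : ℝ)) (Ici 0) := fun r hr => by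
        have := hr.1
        simp only [mem_Ici]; positivity
      refine intervalIntegral.integral_eq_sub_of_hasDeriv_right_of_le (f := fun r => u ((n + r) * τ))
        hs0 ?_ (fun r hr => ?_) ?_
      · refine (hu.mono fun x hx => ?_).comp (by fun_prop) hmaps
        simp only [mem_Ici] at hx ⊢; linarith
      · have hr' : 0 ≤ (n + r) * τ := hmaps ⟨hr.1.le, hr.2.le⟩
        have hlin : HasDerivWithinAt (fun r : ℝ => (n + r) * τ) (1 * τ) (Ioi r) r :=
          (((hasDerivAt_id r).const_add (n : ℝ)).mul_const τ).hasDerivWithinAt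
        have := (hd _ hr').scomp r hlin (fun x hx => by
          have h1 : r < x := hx
          have h2 := hr.1
          have : 0 < x := h2.trans h1
          simp only [mem_Ici]; positivity)
        refine HasDerivWithinAt.congr_deriv this ?_
        rw [smul_eq_mul, show -τ + (n + r) * τ = (n + r) * τ - τ by ring]
        ring
      · refine ContinuousOn.intervalIntegrable ?_
        rw [uIcc_of_le hs0]
        refine continuousOn_const.mul (hu.comp (by fun_prop) fun r hr => ?_)
        have := hmaps hr
        simp only [mem_Ici] at this ⊢; linarith
    have hint' : ∫ r in (0 : ℝ)..s, IccExtend (zero_le_one' ℝ)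
        (fun s : Icc (0 : ℝ) 1 => (u (-τ + (n + s) * τ) : ℂ)) r =
        ((∫ r in (0 : ℝ)..s, u (-τ + (n + r) * τ) : ℝ) : ℂ) := by
      rw [← intervalIntegral.integral_ofReal]
      refine intervalIntegral.integral_congr fun r hr => ?_
      rw [uIcc_of_le hs0] at hr
      exact IccExtend_of_mem _ _ ⟨hr.1, hr.2.trans s.2.2⟩
    rw [intervalIntegral.integral_const_mul] at hint
    rw [stepOp_apply]
    simp only [ContinuousMap.coe_mk]
    rw [hint', ← Complex.ofReal_mul, ← Complex.ofReal_sub]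
    congr 1
    have e1 : -τ + (((n + 1 : ℕ) : ℝ) + s) * τ = (n + s) * τ := by push_cast; ring
    have e2 : -τ + ((n : ℝ) + ((1 : Icc (0 : ℝ) 1) : ℝ)) * τ = (n + 0) * τ := by
      simp only [Icc.coe_one]
      ring
    rw [e1, e2]
    linarith
  have hiter (n : ℕ) : (⟨_, hseg n⟩ : C(Icc (0 : ℝ) 1, ℂ)) =
      (stepOp ((c * τ : ℝ) : ℂ) ^ n) ⟨_, hseg 0⟩ := by
    induction n with
    | zero => rfl
    | succ n ih => rw [hstep, ih, pow_succ']; rfl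
  have hφ0 : ‖(⟨_, hseg 0⟩ : C(Icc (0 : ℝ) 1, ℂ))‖ ≤ M := by
    rw [ContinuousMap.norm_le _ hM0]
    intro s
    simp only [ContinuousMap.coe_mk, Complex.norm_real, Real.norm_eq_abs]
    have h1 := s.2.1
    have h2 := s.2.2
    refine hM _ ⟨?_, ?_⟩
    · simp only [Nat.cast_zero, zero_add]; nlinarith
    · simp only [Nat.cast_zero, zero_add]; nlinarith
  -- History `n` covers `[(n - 1) τ, n τ]`, so `t` lies on history `n + 1`; since `n + 1 > t/τ`,
  -- rounding costs no extra constant.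
  set n := ⌊t / τ⌋₊ with hn
  have ht' : 0 ≤ t / τ := by positivity
  have hn1 : (n : ℝ) ≤ t / τ := Nat.floor_le ht'
  have hn2 : t / τ < n + 1 := Nat.lt_floor_add_one _
  have hs : t / τ - n ∈ Icc (0 : ℝ) 1 := ⟨by linarith, by linarith⟩
  have hval : (u t : ℂ) = (⟨_, hseg (n + 1)⟩ : C(Icc (0 : ℝ) 1, ℂ)) ⟨_, hs⟩ := by
    simp only [ContinuousMap.coe_mk]
    congr 2
    push_cast
    field_simp
    ring
  have hexp : Real.exp (-(-Real.log r / τ) * t) = r ^ (t / τ) := by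
    rw [Real.rpow_def_of_pos hr0]
    congr 1
    ring
  rw [hexp, ← Real.norm_eq_abs, ← Complex.norm_real, hval, hiter]
  calc _ ≤ ‖(stepOp ((c * τ : ℝ) : ℂ) ^ (n + 1)) ⟨_, hseg 0⟩‖ := ContinuousMap.norm_coe_le_norm _ _
    _ ≤ ‖stepOp ((c * τ : ℝ) : ℂ) ^ (n + 1)‖ * M :=
        (ContinuousLinearMap.le_opNorm _ _).trans (by gcongr)
    _ ≤ C * r ^ (n + 1) * M := by gcongr; exact hpow _
    _ ≤ C * r ^ (t / τ) * M := by
        gcongr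
        rw [← Real.rpow_natCast]
        exact Real.rpow_le_rpow_of_exponent_ge hr0 hr1.le (by push_cast; linarith)


/-! ### Scalar delay equation: non-decaying solutions. -/

/-- For `κ ≥ π / 2` the equation `w e^w = -κ` has a root `w = x + i y` with `x ≥ 0`, `y > 0`. -/
theorem exists_root_of_pi_div_two_le {κ : ℝ} (hκ : Real.pi / 2 ≤ κ) :
    ∃ x y : ℝ, 0 ≤ x ∧ 0 < y ∧ x = -(κ * (Real.exp (-x) * Real.cos y)) ∧
      y = κ * (Real.exp (-x) * Real.sin y) := by
  have hpi := Real.pi_pos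
  -- `x = -y cot y`, and `κ` is attained by `y ↦ y e^x / sin y`
  set X : ℝ → ℝ := fun y => -(y * (Real.cos y / Real.sin y)) with hX
  set g : ℝ → ℝ := fun y => κ * (Real.exp (-X y) * Real.sin y) - y with hg
  have hXnonneg {y : ℝ} (h1 : Real.pi / 2 ≤ y) (h2 : y < Real.pi) : 0 ≤ X y := by
    have hsin : 0 < Real.sin y := Real.sin_pos_of_pos_of_lt_pi (by linarith) h2
    have hcos : Real.cos y ≤ 0 := Real.cos_nonpos_of_pi_div_two_le_of_le h1 (by linarith)
    have := mul_nonpos_of_nonneg_of_nonpos (by linarith : 0 ≤ y)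
      (div_nonpos_of_nonpos_of_nonneg hcos hsin.le)
    simp only [hX]; linarith
  -- The cotangent is singular at `π`, so the intermediate value theorem is applied up to a point
  -- just below it, where `κ sin y < y` already holds.
  obtain ⟨y₁, ⟨hy₁, hy₁'⟩, hneg⟩ : ∃ y₁ ∈ Ioo (Real.pi / 2) Real.pi, κ * Real.sin y₁ - y₁ < 0 := by
    have hcont : ContinuousAt (fun y : ℝ => κ * Real.sin y - y) Real.pi := by fun_prop
    have hev : ∀ᶠ y in 𝓝[<] Real.pi, κ * Real.sin y - y < 0 :=
      (hcont.eventually_lt_const (by simp [hpi])).filter_mono nhdsWithin_le_nhds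
    have hIoo : ∀ᶠ y in 𝓝[<] Real.pi, y ∈ Ioo (Real.pi / 2) Real.pi :=
      Ioo_mem_nhdsLT (by linarith)
    obtain ⟨y₁, h1, h2⟩ := (hIoo.and hev).exists
    exact ⟨y₁, h1, h2⟩
  have hsin {y : ℝ} (hy : y ∈ Icc (Real.pi / 2) y₁) : 0 < Real.sin y :=
    Real.sin_pos_of_pos_of_lt_pi (by linarith [hy.1]) (by linarith [hy.2])
  have hXc : ContinuousOn X (Icc (Real.pi / 2) y₁) :=
    (continuousOn_id.mul (Real.continuous_cos.continuousOn.div Real.continuous_sin.continuousOn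
      fun y hy => (hsin hy).ne')).neg
  have hgc : ContinuousOn g (Icc (Real.pi / 2) y₁) :=
    (continuousOn_const.mul (hXc.neg.rexp.mul Real.continuous_sin.continuousOn)).sub continuousOn_id
  have hleft : 0 ≤ g (Real.pi / 2) := by simp [hg, hX, hκ]
  have hright : g y₁ ≤ 0 := by
    have h1 : Real.exp (-X y₁) ≤ 1 := Real.exp_le_one_iff.2 (by linarith [hXnonneg hy₁.le hy₁'])
    have h2 := hsin ⟨hy₁.le, le_rfl⟩
    have h3 : Real.exp (-X y₁) * Real.sin y₁ ≤ Real.sin y₁ := mul_le_of_le_one_left h2.le h1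
    have h4 := mul_le_mul_of_nonneg_left h3 (by linarith : 0 ≤ κ)
    simp only [hg]; linarith
  obtain ⟨y, hy, hgy⟩ := intermediate_value_Icc' hy₁.le hgc ⟨hright, hleft⟩
  have hy2 : y = κ * (Real.exp (-X y) * Real.sin y) := by simp only [hg] at hgy; linarith
  refine ⟨X y, y, hXnonneg hy.1 (hy.2.trans_lt hy₁'), by linarith [hy.1], ?_, hy2⟩
  have hs := hsin hy
  calc X y = -(y * (Real.cos y / Real.sin y)) := rfl
    _ = -(κ * (Real.exp (-X y) * Real.sin y) * (Real.cos y / Real.sin y)) := by rw [← hy2]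
    _ = -(κ * (Real.exp (-X y) * Real.cos y)) := by field_simp

theorem exists_complex_root {c τ : ℝ} (hτ : 0 < τ) (h : Real.pi / 2 ≤ c * τ) :
    ∃ z : ℂ, 0 ≤ z.re ∧ 0 < z.im ∧ z = -(c * Complex.exp (-(z * τ))) := by
  obtain ⟨x, y, hx, hy, h1, h2⟩ := exists_root_of_pi_div_two_le h
  refine ⟨⟨x / τ, y / τ⟩, by positivity, by positivity, ?_⟩
  have e : -((⟨x / τ, y / τ⟩ : ℂ) * τ) = ⟨-x, -y⟩ := by
    apply Complex.ext <;> simp [hτ.ne']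
  rw [e]
  apply Complex.ext
  · simp [Complex.exp_re]
    field_simp
    linarith
  · simp [Complex.exp_im]
    field_simp
    linarith

/-- For `c τ ≥ π / 2` the equation `u'(t) = -c u(t - τ)` has a solution that does not tend to
zero. -/
theorem exists_scalar_nondecaying {c τ : ℝ} (hτ : 0 < τ) (h : Real.pi / 2 ≤ c * τ) :
    ∃ u : ℝ → ℝ, Continuous u ∧ (∀ t, HasDerivAt u (-c * u (t - τ)) t) ∧
      ∃ᶠ t in atTop, 1 ≤ u t := by
  obtain ⟨z, hre, him, hz⟩ := exists_complex_root hτ h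
  have hd (t : ℝ) : HasDerivAt (fun t : ℝ => (Complex.exp (z * t)).re)
      (z * Complex.exp (z * t)).re t := by
    have h1 : HasDerivAt (fun t : ℝ => z * (t : ℂ)) (z * 1) t :=
      (Complex.ofRealCLM.hasDerivAt (x := t)).const_mul z
    have h2 := h1.cexp
    have h3 := Complex.reCLM.hasFDerivAt.comp_hasDerivAt t h2
    refine HasDerivAt.congr_deriv h3 ?_
    simp [mul_comm]
  refine ⟨fun t => (Complex.exp (z * t)).re, by fun_prop, fun t => ?_, ?_⟩
  · convert hd t using 1
    have : z * Complex.exp (z * t) = ((-c : ℝ) : ℂ) * Complex.exp (z * (t - τ : ℝ)) := by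
      conv_lhs => enter [1]; rw [hz]
      rw [Complex.ofReal_sub, mul_sub, sub_eq_add_neg (z * (t : ℂ)), Complex.exp_add]
      push_cast; ring
    rw [this, Complex.re_ofReal_mul]
  -- Sampling at multiples of the period `2π / Im z` makes the cosine equal to `1`.
  · have htend : Tendsto (fun n : ℕ => (n : ℝ) * (2 * Real.pi / z.im)) atTop atTop :=
      tendsto_natCast_atTop_atTop.atTop_mul_const (by positivity)
    refine htend.frequently (Eventually.frequently (Eventually.of_forall fun n => ?_))
    simp only [Complex.exp_re]
    have e1 : (z * ((n * (2 * Real.pi / z.im) : ℝ) : ℂ)).im = n * (2 * Real.pi) := by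
      rw [Complex.im_mul_ofReal]; field_simp
    have e2 : 0 ≤ (z * ((n * (2 * Real.pi / z.im) : ℝ) : ℂ)).re := by
      rw [Complex.re_mul_ofReal]; positivity
    rw [e1, Real.cos_nat_mul_two_pi, mul_one]
    exact Real.one_le_exp e2


/-! ### Factorised characteristic function and its imaginary roots. -/

theorem scaledChar_eq (a b k l : ℝ) (z : ℂ) (τ : ℝ) :
    scaledChar (armsMatrix a b k l) z τ = z ^ 2 + τ * (a + b) * z * Complex.exp (-z) +
      τ ^ 2 * (armsMatrix a b k l).det * Complex.exp (-z) ^ 2 := by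
  simp [scaledChar, charFun, armsMatrix, Matrix.det_fin_two]
  ring

theorem scaledChar_eq_mul {a b k l p q : ℝ} (hs : p + q = a + b)
    (hd : p * q = (armsMatrix a b k l).det) (z : ℂ) (τ : ℝ) :
    scaledChar (armsMatrix a b k l) z τ =
      (z + τ * p * Complex.exp (-z)) * (z + τ * q * Complex.exp (-z)) := by
  rw [scaledChar_eq, ← hd]
  have : (p : ℂ) + q = a + b := by exact_mod_cast hs
  rw [← this]; push_cast; ring

theorem sigmaN_pos (n : ℕ) : 0 < sigmaN n := by
  have := Real.pi_pos
  unfold sigmaN; positivity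

theorem cexp_neg_sigmaN (n : ℕ) : Complex.exp (-(sigmaN n * Complex.I)) = -Complex.I := by
  have : -(sigmaN n * Complex.I : ℂ) =
      -Real.pi / 2 * Complex.I + ((-n : ℤ) : ℂ) * (2 * Real.pi * Complex.I) := by
    unfold sigmaN; push_cast; ring
  rw [this, Complex.exp_add, Complex.exp_int_mul_two_pi_mul_I, mul_one, neg_div, neg_mul,
    Complex.exp_neg, Complex.exp_pi_div_two_mul_I, Complex.inv_I]

theorem cexp_sigmaN (n : ℕ) : Complex.exp (sigmaN n * Complex.I) = Complex.I := by
  rw [← inv_inj, ← Complex.exp_neg, cexp_neg_sigmaN, Complex.inv_I]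

/-- Real and imaginary parts give `cos σ = 0` and `σ = c sin σ`; positivity of `c` and `σ` selects
`sin σ = 1`, discarding `3π/2` modulo `2π`. -/
theorem factor_I_eq_zero_iff {c σ : ℝ} (hc : 0 < c) (hσ : 0 < σ) :
    (σ * Complex.I + c * Complex.exp (-(σ * Complex.I)) = 0) ↔ ∃ n : ℕ, σ = sigmaN n ∧ c = σ := by
  constructor
  · intro h
    have h1 := congrArg Complex.re h
    have h2 := congrArg Complex.im h
    simp [Complex.exp_re, Complex.exp_im] at h1 h2
    have hcos : Real.cos σ = 0 := h1.resolve_left hc.ne'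
    have hsin : 0 < Real.sin σ := by
      by_contra hle
      nlinarith
    have hsin1 : Real.sin σ = 1 := by
      nlinarith [Real.sin_sq_add_cos_sq σ]
    obtain ⟨m, hm⟩ := Real.sin_eq_one_iff.1 hsin1
    have hpi := Real.pi_pos
    have hm0 : 0 ≤ m := by
      by_contra hlt
      have : (m : ℝ) ≤ -1 := by exact_mod_cast (by omega : m ≤ -1)
      nlinarith
    lift m to ℕ using hm0
    refine ⟨m, ?_, ?_⟩
    · rw [← hm]; unfold sigmaN; push_cast; ring
    · rw [hsin1] at h2; linarith
  · rintro ⟨n, hn, rfl⟩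
    rw [hn, cexp_neg_sigmaN]; ring

theorem factor_neg_I_eq_zero {c σ : ℝ} (h : σ * Complex.I + c * Complex.exp (-(σ * Complex.I)) = 0) :
    -(σ * Complex.I) + c * Complex.exp (-(-(σ * Complex.I))) = 0 := by
  have := congrArg (starRingEnd ℂ) h
  simpa [← Complex.exp_conj] using this

theorem imaginary_roots_iff {a b k l p q : ℝ} (hp : 0 < p) (hq : 0 < q) (hs : p + q = a + b)
    (hd : p * q = (armsMatrix a b k l).det) {τ σ : ℝ} (hτ : 0 < τ) (hσ : 0 < σ) :
    (scaledChar (armsMatrix a b k l) (σ * Complex.I) τ = 0 ∧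
      scaledChar (armsMatrix a b k l) (-(σ * Complex.I)) τ = 0) ↔
    ∃ n : ℕ, σ = sigmaN n ∧ (τ = sigmaN n / p ∨ τ = sigmaN n / q) := by
  have key (c : ℝ) (hc : 0 < c) : (σ * Complex.I + τ * c * Complex.exp (-(σ * Complex.I)) = 0) ↔
      ∃ n : ℕ, σ = sigmaN n ∧ τ = sigmaN n / c := by
    have := factor_I_eq_zero_iff (mul_pos hτ hc) hσ
    push_cast at this
    rw [this]
    refine exists_congr fun n => and_congr_right fun hn => ?_
    rw [eq_div_iff hc.ne', hn]
  have hconj (c : ℝ) (h : σ * Complex.I + τ * c * Complex.exp (-(σ * Complex.I)) = 0) :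
      -(σ * Complex.I) + τ * c * Complex.exp (-(-(σ * Complex.I))) = 0 := by
    have := factor_neg_I_eq_zero (c := τ * c) (σ := σ) (by push_cast; exact h)
    push_cast at this; exact this
  simp only [scaledChar_eq_mul hs hd, mul_eq_zero]
  rw [show (∃ n : ℕ, σ = sigmaN n ∧ (τ = sigmaN n / p ∨ τ = sigmaN n / q)) ↔ _ from
    (exists_congr fun n => and_or_left).trans exists_or, ← key p hp, ← key q hq]
  constructor
  · exact fun h => h.1
  · exact fun h => ⟨h, h.imp (hconj p) (hconj q)⟩

/-! ### Transversal crossing. -/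

/-- A simple purely imaginary root of the factor `z + τ p e^{-z}` crosses to the right. -/
theorem crossesToRight_mul {p q : ℝ} (hpq : p ≠ q) {z₀ : ℂ} {τ₀ : ℝ} (hτ₀ : 0 < τ₀)
    (hre : z₀.re = 0) (hne : z₀ ≠ 0) (hroot : z₀ + τ₀ * p * Complex.exp (-z₀) = 0) :
    CrossesToRight (fun z τ => (z + τ * p * Complex.exp (-z)) * (z + τ * q * Complex.exp (-z)))
      z₀ τ₀ := by
  have h1 : 1 + z₀ ≠ 0 := fun h => by
    have := congrArg Complex.re h
    simp [hre] at this
  have h1e : (1 + z₀) * Complex.exp z₀ ≠ 0 := mul_ne_zero h1 (Complex.exp_ne_zero _)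
  have hfactor (c : ℝ) (z : ℂ) (τ : ℝ) :
      z + τ * c * Complex.exp (-z) = 0 ↔ z * Complex.exp z = ((-(τ * c) : ℝ) : ℂ) := by
    rw [Complex.exp_neg]
    have := Complex.exp_ne_zero z
    field_simp
    push_cast
    constructor <;> intro h <;> linear_combination h
  -- The branch is the local inverse of `f` along `τ ↦ -τ p`. It exists since `f'(z₀) = (1 + z₀)
  -- e^{z₀}` and `Re z₀ = 0`.
  set f : ℂ → ℂ := fun z => z * Complex.exp z with hf
  have hfc : ContDiff ℂ ω f := by fun_prop
  have hfd : HasDerivAt f ((1 + z₀) * Complex.exp z₀) z₀ := by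
    refine ((hasDerivAt_id z₀).mul (Complex.hasDerivAt_exp z₀)).congr_deriv ?_
    simp; ring
  set e : ℂ ≃L[ℂ] ℂ := ContinuousLinearEquiv.unitsEquivAut ℂ (Units.mk0 _ h1e) with he
  have hfd' : HasFDerivAt f (e : ℂ →L[ℂ] ℂ) z₀ := by
    have : (e : ℂ →L[ℂ] ℂ) = ContinuousLinearMap.toSpanSingleton ℂ ((1 + z₀) * Complex.exp z₀) := by
      ext
      simp [he]
    rw [this]
    exact hfd
  set R := hfc.contDiffAt.toOpenPartialHomeomorph f hfd' (by simp) with hR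
  have hRf (z : ℂ) : R z = f z := rfl
  have hsrc : z₀ ∈ R.source := hfc.contDiffAt.mem_toOpenPartialHomeomorph_source hfd' (by simp)
  have hz₀ : f z₀ = ((-(τ₀ * p) : ℝ) : ℂ) := (hfactor p z₀ τ₀).1 hroot
  have hsymm : ContDiffAt ℂ ω R.symm (f z₀) :=
    hfc.contDiffAt.to_localInverse hfd' (by simp)
  have hsymm0 : R.symm (f z₀) = z₀ := R.left_inv hsrc
  have hsymmd : HasDerivAt R.symm ((1 + z₀) * Complex.exp z₀)⁻¹ (f z₀) := by
    refine R.hasDerivAt_symm (R.map_source hsrc) h1e ?_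
    rw [hsymm0]; exact hfd
  -- the second factor does not vanish at `(z₀, τ₀)`
  have hother : z₀ + τ₀ * q * Complex.exp (-z₀) ≠ 0 := fun h => by
    have : ((-(τ₀ * p) : ℝ) : ℂ) = ((-(τ₀ * q) : ℝ) : ℂ) := by
      rw [← (hfactor p z₀ τ₀).1 hroot, ← (hfactor q z₀ τ₀).1 h]
    have := Complex.ofReal_injective this
    exact hpq (mul_left_cancel₀ hτ₀.ne' (neg_injective this))
  set ℓ : ℝ → ℂ := fun τ => ((-(τ * p) : ℝ) : ℂ) with hℓ
  have hℓc : ContDiff ℝ ∞ ℓ := by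
    have : ContDiff ℝ ∞ fun τ : ℝ => -(τ * p) := (contDiff_id.mul contDiff_const).neg
    exact Complex.ofRealCLM.contDiff.comp this
  have hℓ0 : ℓ τ₀ = f z₀ := hz₀.symm
  -- the neighbourhoods
  have hev1 : ∀ᶠ x in 𝓝 (z₀, τ₀), x.1 ∈ R.source ∧ x.1 + x.2 * q * Complex.exp (-x.1) ≠ 0 := by
    refine (continuousAt_fst.eventually (R.open_source.mem_nhds hsrc)).and ?_
    refine ContinuousAt.eventually_ne ?_ hother
    fun_prop
  obtain ⟨δ, hδ, hball⟩ := Metric.eventually_nhds_iff_ball.1 hev1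
  have hlocal : ContDiffAt ℂ ω R.symm (ℓ τ₀) := by rw [hℓ0]; exact hsymm
  have hev2 : ∀ᶠ τ in 𝓝 τ₀, ContDiffAt ℝ ∞ (R.symm ∘ ℓ) τ ∧ ℓ τ ∈ R.target ∧
      R.symm (ℓ τ) ∈ Metric.ball z₀ δ := by
    have hev := (hlocal.eventually (by simp)).and
      ((R.open_target.eventually_mem
        (by rw [hℓ0]; exact R.map_source hsrc : ℓ τ₀ ∈ R.target)).and
        (hlocal.continuousAt.eventually (by
          rw [hℓ0, hsymm0]; exact Metric.ball_mem_nhds z₀ hδ :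
            ∀ᶠ w in 𝓝 (R.symm (ℓ τ₀)), w ∈ Metric.ball z₀ δ)))
    filter_upwards [hℓc.continuous.continuousAt.eventually hev] with τ hτ
    exact ⟨((hτ.1.restrict_scalars ℝ).of_le le_top).comp τ hℓc.contDiffAt, hτ.2⟩
  obtain ⟨ε', hε', hIoo⟩ := Metric.eventually_nhds_iff_ball.1 hev2
  rw [Real.ball_eq_Ioo] at hIoo
  set ε := min ε' δ with hε
  have hεpos : 0 < ε := lt_min hε' hδ
  have hsub (τ : ℝ) (hτ : τ ∈ Ioo (τ₀ - ε) (τ₀ + ε)) :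
      τ ∈ Ioo (τ₀ - ε') (τ₀ + ε') ∧ τ ∈ Metric.ball τ₀ δ := by
    have h1 := min_le_left ε' δ
    have h2 := min_le_right ε' δ
    rw [Real.ball_eq_Ioo]
    exact ⟨⟨by linarith [hτ.1], by linarith [hτ.2]⟩, ⟨by linarith [hτ.1], by linarith [hτ.2]⟩⟩
  refine ⟨hre, ε, hεpos, δ, hδ, R.symm ∘ ℓ, ?_, ?_, ?_, ?_⟩
  · exact fun τ hτ => (hIoo τ (hsub τ hτ).1).1.contDiffWithinAt
  · simp only [Function.comp_apply, hℓ0, hsymm0]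
  · intro τ hτ
    obtain ⟨hτ1, hτ2⟩ := hsub τ hτ
    obtain ⟨-, htgt, hmem⟩ := hIoo τ hτ1
    refine ⟨hmem, fun z hz => ?_⟩
    obtain ⟨hzs, hzne⟩ := hball (z, τ) (by
      rw [← ball_prod_same]; exact ⟨hz, hτ2⟩)
    rw [mul_eq_zero, or_iff_left hzne, hfactor]
    change R z = ℓ τ ↔ z = R.symm (ℓ τ)
    constructor
    · intro h; rw [← h, R.left_inv hzs]
    · intro h; rw [h, R.right_inv htgt]
  · have hℓd : HasDerivAt ℓ ((-p : ℝ) : ℂ) τ₀ := by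
      have : HasDerivAt (fun τ : ℝ => -(τ * p)) (-p) τ₀ := by
        refine ((hasDerivAt_id τ₀).mul_const p).neg.congr_deriv ?_
        simp
      exact this.ofReal_comp
    have hsymmd' : HasDerivAt R.symm ((1 + z₀) * Complex.exp z₀)⁻¹ (ℓ τ₀) := by
      rw [hℓ0]; exact hsymmd
    have hcomp := hsymmd'.comp τ₀ hℓd
    rw [hcomp.deriv]
    -- Substituting `-p = z₀ e^{z₀} / τ₀` turns the derivative into `z₀ / (τ₀ (1 + z₀))`, whose real
    -- part is `y² / (τ₀ (1 + y²))` for `z₀ = i y`.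
    have hval : ((1 + z₀) * Complex.exp z₀)⁻¹ * ((-p : ℝ) : ℂ) =
        ((τ₀⁻¹ : ℝ) : ℂ) * (z₀ / (1 + z₀)) := by
      have hE := Complex.exp_ne_zero z₀
      have hτc : (τ₀ : ℂ) ≠ 0 := by exact_mod_cast hτ₀.ne'
      have : z₀ * Complex.exp z₀ = -(τ₀ * p) := by rw [← Complex.ofReal_mul, ← Complex.ofReal_neg]; exact hz₀
      push_cast
      field_simp
      linear_combination -this
    rw [hval, Complex.re_ofReal_mul]
    have him : z₀.im ≠ 0 := fun h => hne (Complex.ext hre h)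
    have : (z₀ / (1 + z₀)).re = z₀.im ^ 2 / (1 + z₀.im ^ 2) := by
      simp [Complex.div_re, Complex.normSq_apply, hre]
      ring
    rw [this]
    positivity


/-! ### Eigenvalues, critical delays and the equilibrium. -/

theorem det_armsMatrix (a b k l : ℝ) : (armsMatrix a b k l).det = a * b - k * l := by
  simp [armsMatrix, Matrix.det_fin_two]

/-- The eigenvalues `-p`, `-q` of the arms matrix are real, distinct and negative. -/
theorem exists_rates {a b k l : ℝ} (ha : 0 < a) (hb : 0 < b) (hk : 0 < k) (hl : 0 < l)
    (hdet : 0 < (armsMatrix a b k l).det) :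
    ∃ p q : ℝ, 0 < p ∧ p < q ∧ p + q = a + b ∧ p * q = (armsMatrix a b k l).det ∧
      q - p = Real.sqrt ((a + b) ^ 2 - 4 * (armsMatrix a b k l).det) := by
  set d := (armsMatrix a b k l).det with hd
  have hdisc : 0 < (a + b) ^ 2 - 4 * d := by
    rw [hd, det_armsMatrix]
    nlinarith [sq_nonneg (a - b), mul_pos hk hl]
  set S := Real.sqrt ((a + b) ^ 2 - 4 * d) with hS
  have hS0 : 0 < S := Real.sqrt_pos.2 hdisc
  have hS2 : S ^ 2 = (a + b) ^ 2 - 4 * d := Real.sq_sqrt hdisc.le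
  have hSlt : S < a + b := by
    refine lt_of_pow_lt_pow_left₀ 2 (by positivity) ?_
    linarith
  refine ⟨(a + b - S) / 2, (a + b + S) / 2, by linarith, by linarith, by ring, ?_, by ring⟩
  nlinarith

theorem tauThreshold_eq {a b k l p q : ℝ} (hp : 0 < p) (hpq : p < q) (hs : p + q = a + b)
    (hd : p * q = (armsMatrix a b k l).det)
    (hS : q - p = Real.sqrt ((a + b) ^ 2 - 4 * (armsMatrix a b k l).det)) :
    tauThreshold a b k l = Real.pi / 2 / q := by
  have hq := hp.trans hpq
  rw [tauThreshold, ← hS, ← hd, ← hs]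
  field_simp
  ring

theorem tauPlus_eq {a b k l p q : ℝ} (hp : 0 < p) (hpq : p < q) (hs : p + q = a + b)
    (hd : p * q = (armsMatrix a b k l).det)
    (hS : q - p = Real.sqrt ((a + b) ^ 2 - 4 * (armsMatrix a b k l).det)) (n : ℕ) :
    tauPlus a b k l n = sigmaN n / p := by
  have hq := hp.trans hpq
  rw [tauPlus, ← hS, ← hd, ← hs]
  field_simp
  ring

theorem tauMinus_eq {a b k l p q : ℝ} (hp : 0 < p) (hpq : p < q) (hs : p + q = a + b)
    (hd : p * q = (armsMatrix a b k l).det)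
    (hS : q - p = Real.sqrt ((a + b) ^ 2 - 4 * (armsMatrix a b k l).det)) (n : ℕ) :
    tauMinus a b k l n = sigmaN n / q := by
  have hq := hp.trans hpq
  rw [tauMinus, ← hS, ← hd, ← hs]
  field_simp
  ring

/-- Assuming `p ≠ q` instead of `p < q` lets the two rates be exchanged, covering both families of
delays. -/
theorem crossesToRight_scaledChar {a b k l p q : ℝ} (hp : 0 < p) (hpq : p ≠ q)
    (hs : p + q = a + b) (hd : p * q = (armsMatrix a b k l).det) (n : ℕ) :
    CrossesToRight (scaledChar (armsMatrix a b k l)) (sigmaN n * Complex.I) (sigmaN n / p) ∧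
    CrossesToRight (scaledChar (armsMatrix a b k l)) (-(sigmaN n * Complex.I)) (sigmaN n / p) := by
  have hσ := sigmaN_pos n
  have hσ' : (sigmaN n : ℂ) ≠ 0 := by exact_mod_cast hσ.ne'
  have hp' : (p : ℂ) ≠ 0 := by exact_mod_cast hp.ne'
  have h : scaledChar (armsMatrix a b k l) = fun (z : ℂ) (τ : ℝ) =>
      (z + τ * p * Complex.exp (-z)) * (z + τ * q * Complex.exp (-z)) := by
    funext z τ; exact scaledChar_eq_mul hs hd z τ
  rw [h]
  constructor <;> refine crossesToRight_mul hpq (by positivity) (by simp) (by simp [hσ']) ?_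
  · rw [cexp_neg_sigmaN]; push_cast; field_simp; ring
  · rw [neg_neg, cexp_sigmaN]; push_cast; field_simp; ring

theorem hillField_eq_mulVec (a b k l β₁ β₂ : ℝ) (P : Fin 2 → ℝ) :
    hillField a b k l β₁ β₂ P = armsMatrix a b k l *ᵥ P + ![β₁, β₂] := by
  ext i
  fin_cases i <;> simp [hillField, armsMatrix, dotProduct, Fin.sum_univ_two] <;> ring

theorem isEquilibrium_iff {a b k l : ℝ} (hdet : 0 < (armsMatrix a b k l).det) (β₁ β₂ : ℝ)
    (P : Fin 2 → ℝ) : IsEquilibrium (hillField a b k l β₁ β₂) P ↔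
      P = -((armsMatrix a b k l)⁻¹ *ᵥ ![β₁, β₂]) := by
  have hu : IsUnit (armsMatrix a b k l).det := hdet.ne'.isUnit
  rw [IsEquilibrium, hillField_eq_mulVec, add_eq_zero_iff_eq_neg]
  constructor
  · intro h
    rw [← Matrix.mulVec_neg, ← h, Matrix.mulVec_mulVec, Matrix.nonsing_inv_mul _ hu,
      Matrix.one_mulVec]
  · rintro rfl
    rw [Matrix.mulVec_neg, Matrix.mulVec_mulVec, Matrix.mul_nonsing_inv _ hu, Matrix.one_mulVec]

/-- By Cramer's rule `det A · P` has components `b β₁ + k β₂` and `l β₁ + a β₂`. -/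
theorem equilibrium_pos {a b k l β₁ β₂ : ℝ} (ha : 0 < a) (hb : 0 < b) (hk : 0 < k) (hl : 0 < l)
    (hβ₁ : 0 < β₁) (hβ₂ : 0 < β₂) (hdet : 0 < (armsMatrix a b k l).det) (i : Fin 2) :
    0 < (-((armsMatrix a b k l)⁻¹ *ᵥ ![β₁, β₂])) i := by
  set P := -((armsMatrix a b k l)⁻¹ *ᵥ ![β₁, β₂]) with hP
  have h : hillField a b k l β₁ β₂ P = 0 := (isEquilibrium_iff hdet β₁ β₂ P).2 hP
  have h0 := congrFun h 0
  have h1 := congrFun h 1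
  simp only [hillField, Matrix.cons_val_zero, Matrix.cons_val_one, Pi.zero_apply] at h0 h1
  rw [det_armsMatrix] at hdet
  have e0 : (a * b - k * l) * P 0 = b * β₁ + k * β₂ := by linear_combination -b * h0 - k * h1
  have e1 : (a * b - k * l) * P 1 = l * β₁ + a * β₂ := by linear_combination -l * h0 - a * h1
  have : ∀ j : Fin 2, 0 < P j := Fin.forall_fin_two.2
    ⟨pos_of_mul_pos_right (e0 ▸ by positivity) hdet.le,
      pos_of_mul_pos_right (e1 ▸ by positivity) hdet.le⟩
  exact this i

/-! ### Stability and instability of the planar system. -/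

/-- Along an eigenrow `(l, a - c)` of the arms matrix, for the eigenvalue `-c`, a solution of Hill's
system satisfies a scalar delay equation. -/
theorem IsSolution.hasDerivWithinAt_eigenrow {a b k l β₁ β₂ c τ : ℝ} {P : Fin 2 → ℝ}
    (hP : IsEquilibrium (hillField a b k l β₁ β₂) P) (hc : c ^ 2 - (a + b) * c + (a * b - k * l) = 0)
    {φ : C(Icc (-τ) 0, Fin 2 → ℝ)} {X : ℝ → Fin 2 → ℝ}
    (hX : IsSolution (hillField a b k l β₁ β₂) τ φ X) {t : ℝ} (ht : 0 ≤ t) :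
    HasDerivWithinAt (fun t => l * (X t 0 - P 0) + (a - c) * (X t 1 - P 1))
      (-c * (l * (X (t - τ) 0 - P 0) + (a - c) * (X (t - τ) 1 - P 1))) (Ici 0) t := by
  have h := hasDerivWithinAt_pi.1 (hX.equation t ht)
  refine ((((h 0).sub_const (P 0)).const_mul l).add
    (((h 1).sub_const (P 1)).const_mul (a - c))).congr_deriv ?_
  have h0 := congrFun hP 0
  have h1 := congrFun hP 1
  simp only [hillField, Matrix.cons_val_zero, Matrix.cons_val_one, Pi.zero_apply] at h0 h1 ⊢
  linear_combination l * h0 + (a - c) * h1 + (-hc) * (X (t - τ) 1 - P 1)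

theorem IsSolution.exists_eigenrow_decay {a b k l β₁ β₂ c τ : ℝ} {P : Fin 2 → ℝ}
    (hP : IsEquilibrium (hillField a b k l β₁ β₂) P) (hl : 0 < l)
    (hc : c ^ 2 - (a + b) * c + (a * b - k * l) = 0) (hc0 : 0 < c) (hτ : 0 < τ)
    (h : c * τ < Real.pi / 2) :
    ∃ K > 0, ∃ α > 0, ∀ (φ : C(Icc (-τ) 0, Fin 2 → ℝ)) (X : ℝ → Fin 2 → ℝ),
      IsSolution (hillField a b k l β₁ β₂) τ φ X → ∀ t, 0 ≤ t →
        |l * (X t 0 - P 0) + (a - c) * (X t 1 - P 1)| ≤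
          K * Real.exp (-α * t) * ‖φ - ContinuousMap.const _ P‖ := by
  obtain ⟨K, hK, α, hα, hdec⟩ := exists_scalar_decay hc0 hτ h
  refine ⟨K * (l + |a - c|), by positivity, α, hα, fun φ X hX t ht => ?_⟩
  have hcomp (i : Fin 2) : ContinuousOn (fun t => X t i) (Ici (-τ)) :=
    continuousOn_pi.1 hX.continuousOn i
  refine (hdec (fun t => l * (X t 0 - P 0) + (a - c) * (X t 1 - P 1))
    ((l + |a - c|) * ‖φ - ContinuousMap.const _ P‖)
    ((continuousOn_const.mul ((hcomp 0).sub continuousOn_const)).add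
      (continuousOn_const.mul ((hcomp 1).sub continuousOn_const)))
    (fun t ht => hX.hasDerivWithinAt_eigenrow hP hc ht) (fun θ hθ => ?_) t ht).trans_eq (by ring)
  have hb (i : Fin 2) : |X θ i - P i| ≤ ‖φ - ContinuousMap.const _ P‖ := by
    refine le_trans ?_ ((φ - ContinuousMap.const _ P).norm_coe_le_norm ⟨θ, hθ⟩)
    have := norm_le_pi_norm ((φ - ContinuousMap.const (Icc (-τ) (0 : ℝ)) P) ⟨θ, hθ⟩) i
    simpa [← hX.initial ⟨θ, hθ⟩] using this
  calc |l * (X θ 0 - P 0) + (a - c) * (X θ 1 - P 1)|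
      ≤ |l * (X θ 0 - P 0)| + |(a - c) * (X θ 1 - P 1)| := abs_add_le _ _
    _ = l * |X θ 0 - P 0| + |a - c| * |X θ 1 - P 1| := by rw [abs_mul, abs_mul, abs_of_pos hl]
    _ ≤ l * ‖φ - ContinuousMap.const _ P‖ + |a - c| * ‖φ - ContinuousMap.const _ P‖ := by
        gcongr <;> exact hb _
    _ = _ := by ring

/-- The eigenrows for `p` and `q` differ by `(0, q - p)`, so their decay bounds the second
coordinate; the first follows because `l ≠ 0`. -/
theorem isEAS_of_lt {a b k l β₁ β₂ p q τ : ℝ} {P : Fin 2 → ℝ} (hl : 0 < l)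
    (hp : 0 < p) (hpq : p < q) (hs : p + q = a + b) (hd : p * q = a * b - k * l)
    (hP : IsEquilibrium (hillField a b k l β₁ β₂) P) (hτ : 0 < τ) (h : q * τ < Real.pi / 2) :
    IsEAS (hillField a b k l β₁ β₂) τ P := by
  have hp' : p * τ < Real.pi / 2 := (mul_lt_mul_of_pos_right hpq hτ).trans h
  obtain ⟨K₁, hK₁, α₁, hα₁, h₁⟩ := IsSolution.exists_eigenrow_decay hP hl (c := p)
    (by rw [← hs, ← hd]; ring) hp hτ hp'
  obtain ⟨K₂, hK₂, α₂, hα₂, h₂⟩ := IsSolution.exists_eigenrow_decay hP hl (c := q)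
    (by rw [← hs, ← hd]; ring) (hp.trans hpq) hτ h
  have hD : 0 < q - p := sub_pos.2 hpq
  set L := (K₁ + K₂) / (q - p) with hL
  have hL0 : 0 < L := by positivity
  -- The system is affine, so the bounds are global and any `δ` would do. The constant adds the
  -- bounds for the two coordinates.
  refine ⟨hP, 1, one_pos, L + (K₁ + |a - p| * L) / l, by positivity, min α₁ α₂, lt_min hα₁ hα₂, ?_⟩
  intro φ _ X hX t ht
  set E := Real.exp (-min α₁ α₂ * t) * ‖φ - ContinuousMap.const _ P‖ with hE
  have hE0 : 0 ≤ E := by positivity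
  have e₁ : |l * (X t 0 - P 0) + (a - p) * (X t 1 - P 1)| ≤ K₁ * E := by
    refine (h₁ φ X hX t ht).trans ?_
    rw [hE, ← mul_assoc]
    gcongr
    exact min_le_left _ _
  have e₂ : |l * (X t 0 - P 0) + (a - q) * (X t 1 - P 1)| ≤ K₂ * E := by
    refine (h₂ φ X hX t ht).trans ?_
    rw [hE, ← mul_assoc]
    gcongr
    exact min_le_right _ _
  have b1 : |X t 1 - P 1| ≤ L * E := by
    have : (q - p) * |X t 1 - P 1| ≤ K₁ * E + K₂ * E := by
      rw [← abs_of_pos hD, ← abs_mul]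
      refine le_trans (le_of_eq ?_) ((abs_sub _ _).trans (add_le_add e₁ e₂))
      congr 1; ring
    rw [hL, div_mul_eq_mul_div, le_div_iff₀ hD]
    linarith
  have b0 : |X t 0 - P 0| ≤ (K₁ + |a - p| * L) / l * E := by
    have : l * |X t 0 - P 0| ≤ K₁ * E + |a - p| * (L * E) := by
      calc l * |X t 0 - P 0| = |(l * (X t 0 - P 0) + (a - p) * (X t 1 - P 1)) -
            (a - p) * (X t 1 - P 1)| := by rw [add_sub_cancel_right, abs_mul, abs_of_pos hl]
        _ ≤ _ := abs_sub _ _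
        _ ≤ _ := by rw [abs_mul]; gcongr
    rw [div_mul_eq_mul_div, le_div_iff₀ hl]
    linarith
  rw [mul_assoc, ← hE, pi_norm_le_iff_of_nonneg (by positivity)]
  have hrest : 0 ≤ (K₁ + |a - p| * L) / l * E := by positivity
  have hrest' : 0 ≤ L * E := by positivity
  refine Fin.forall_fin_two.2 ⟨?_, ?_⟩
  · rw [Pi.sub_apply, Real.norm_eq_abs]; linarith
  · rw [Pi.sub_apply, Real.norm_eq_abs]; linarith

/-- A scalar solution times an eigenvector `(k, a - c)` of the arms matrix, for the eigenvalue `-c`,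
solves Hill's system around an equilibrium. -/
theorem isSolution_eigenvector {a b k l β₁ β₂ c τ ε : ℝ} {P : Fin 2 → ℝ}
    (hP : IsEquilibrium (hillField a b k l β₁ β₂) P) (hc : c ^ 2 - (a + b) * c + (a * b - k * l) = 0)
    {u : ℝ → ℝ} (hu : Continuous u) (hd : ∀ t, HasDerivAt u (-c * u (t - τ)) t)
    {φ : C(Icc (-τ) 0, Fin 2 → ℝ)} (hφ : ∀ θ, φ θ = P + ε • u θ • ![k, a - c]) :
    IsSolution (hillField a b k l β₁ β₂) τ φ fun t => P + ε • u t • ![k, a - c] where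
  continuousOn := Continuous.continuousOn (by fun_prop)
  initial θ := (hφ θ).symm
  equation t _ := by
    refine (((hd t).smul_const ![k, a - c]).const_smul ε).const_add P
      |>.hasDerivWithinAt.congr_deriv ?_
    have h0 := congrFun hP 0
    have h1 := congrFun hP 1
    simp only [hillField, Matrix.cons_val_zero, Matrix.cons_val_one, Pi.zero_apply] at h0 h1
    funext i
    fin_cases i
    · simp [hillField]
      linear_combination -h0
    · simp [hillField]
      linear_combination -h1 + ε * u (t - τ) * hc

/-- A small multiple of the non-decaying solution along `(k, a - c)` starts within `δ` of `P`, yet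
its first coordinate deviates by at least `ε k` at arbitrarily late times. -/
theorem not_isEAS_of_le {a b k l β₁ β₂ c τ : ℝ} {P : Fin 2 → ℝ} (hk : 0 < k)
    (hP : IsEquilibrium (hillField a b k l β₁ β₂) P) (hc : c ^ 2 - (a + b) * c + (a * b - k * l) = 0)
    (hτ : 0 < τ) (h : Real.pi / 2 ≤ c * τ) : ¬ IsEAS (hillField a b k l β₁ β₂) τ P := by
  rintro ⟨-, δ, hδ, K, hK, α, hα, hE⟩
  obtain ⟨u, hu, hd, hfreq⟩ := exists_scalar_nondecaying hτ h
  set ψ : C(Icc (-τ) 0, Fin 2 → ℝ) := ⟨fun θ => u θ • ![k, a - c], by fun_prop⟩ with hψ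
  -- The `+ 1` keeps the denominator positive and makes `ε ‖ψ‖ < δ` strict.
  set ε := δ / (‖ψ‖ + 1) with hε
  have hε0 : 0 < ε := by positivity
  have hsmall : ‖(ContinuousMap.const _ P + ε • ψ) - ContinuousMap.const _ P‖ < δ := by
    rw [add_sub_cancel_left, norm_smul, Real.norm_of_nonneg hε0.le, hε, div_mul_eq_mul_div,
      div_lt_iff₀ (by positivity)]
    linarith
  have hsol : IsSolution (hillField a b k l β₁ β₂) τ (ContinuousMap.const _ P + ε • ψ)
      fun t => P + ε • u t • ![k, a - c] :=
    isSolution_eigenvector hP hc hu hd fun θ => rfl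
  have hbound (t : ℝ) (ht : 0 ≤ t) : ε * |u t| * k ≤ K * Real.exp (-α * t) * δ := by
    have h1 := hE _ hsmall _ hsol t ht
    have h2 := (norm_le_pi_norm _ (0 : Fin 2)).trans h1
    refine le_trans (le_of_eq ?_) (h2.trans (by gcongr))
    rw [add_sub_cancel_left]
    simp [abs_of_pos hε0, abs_of_pos hk, mul_assoc]
  have hlim : Tendsto (fun t => K * Real.exp (-α * t) * δ) atTop (𝓝 0) := by
    have : Tendsto (fun t => Real.exp (-α * t)) atTop (𝓝 0) :=
      Real.tendsto_exp_atBot.comp (tendsto_id.const_mul_atTop_of_neg (neg_lt_zero.2 hα))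
    simpa using (this.const_mul K).mul_const δ
  have hev := (hlim.eventually_lt_const (mul_pos hε0 hk)).and (eventually_ge_atTop 0)
  obtain ⟨t, hut, hlt, ht⟩ := (hfreq.and_eventually hev).exists
  have h1 := hbound t ht
  have h2 : ε * k ≤ ε * |u t| * k := by
    have : 1 ≤ |u t| := hut.trans (le_abs_self _)
    gcongr
    exact le_mul_of_one_le_right hε0.le this
  linarith

end Richardson

theorem theorem2p1 (a b k l β₁ β₂ : ℝ) (ha : 0 < a) (hb : 0 < b) (hk : 0 < k) (hl : 0 < l)
    (hβ₁ : 0 < β₁) (hβ₂ : 0 < β₂) (hdet : 0 < (Richardson.armsMatrix a b k l).det) :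
    -- `P₀ = -A⁻¹ β` is the unique equilibrium of Hill's system, and it is positive;
    -- for every delay it is EAS if and only if the delay is below the threshold
    (∃ P₀ : Fin 2 → ℝ,
      P₀ = -((Richardson.armsMatrix a b k l)⁻¹ *ᵥ ![β₁, β₂]) ∧
      (∀ i, 0 < P₀ i) ∧
      (∀ P, Richardson.IsEquilibrium (Richardson.hillField a b k l β₁ β₂) P ↔ P = P₀) ∧
      ∀ τ : ℝ, 0 < τ →
        (Richardson.IsEAS (Richardson.hillField a b k l β₁ β₂) τ P₀ ↔
          τ < Richardson.tauThreshold a b k l)) ∧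
    -- the purely imaginary characteristic roots
    (∀ τ σ : ℝ, 0 < τ → 0 < σ →
      ((Richardson.scaledChar (Richardson.armsMatrix a b k l) (σ * Complex.I) τ = 0 ∧
        Richardson.scaledChar (Richardson.armsMatrix a b k l) (-(σ * Complex.I)) τ = 0) ↔
        ∃ n : ℕ, σ = Richardson.sigmaN n ∧
          (τ = Richardson.tauPlus a b k l n ∨ τ = Richardson.tauMinus a b k l n))) ∧
    -- both roots of each pair cross the imaginary axis transversally to the right
    (∀ n : ℕ, ∀ τ₀ : ℝ,
      (τ₀ = Richardson.tauPlus a b k l n ∨ τ₀ = Richardson.tauMinus a b k l n) →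
        Richardson.CrossesToRight (Richardson.scaledChar (Richardson.armsMatrix a b k l))
          (Richardson.sigmaN n * Complex.I) τ₀ ∧
        Richardson.CrossesToRight (Richardson.scaledChar (Richardson.armsMatrix a b k l))
          (-(Richardson.sigmaN n * Complex.I)) τ₀) := by
  obtain ⟨p, q, hp, hpq, hs, hd, hS⟩ := Richardson.exists_rates ha hb hk hl hdet
  have hq := hp.trans hpq
  have hd' : p * q = a * b - k * l := by rw [hd, Richardson.det_armsMatrix]
  refine ⟨⟨_, rfl, Richardson.equilibrium_pos ha hb hk hl hβ₁ hβ₂ hdet,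
    Richardson.isEquilibrium_iff hdet β₁ β₂, fun τ hτ => ?_⟩, fun τ σ hτ hσ => ?_, fun n τ₀ hτ₀ => ?_⟩
  · have hP := (Richardson.isEquilibrium_iff hdet β₁ β₂ _).2 rfl
    rw [Richardson.tauThreshold_eq hp hpq hs hd hS, lt_div_iff₀ hq, mul_comm]
    refine ⟨fun h => ?_, fun h => Richardson.isEAS_of_lt hl hp hpq hs hd' hP hτ h⟩
    by_contra hle
    exact Richardson.not_isEAS_of_le hk hP (by rw [← hs, ← hd']; ring) hτ (not_lt.1 hle) h
  · simp only [Richardson.tauPlus_eq hp hpq hs hd hS, Richardson.tauMinus_eq hp hpq hs hd hS]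
    exact Richardson.imaginary_roots_iff hp hq hs hd hτ hσ
  · rw [Richardson.tauPlus_eq hp hpq hs hd hS, Richardson.tauMinus_eq hp hpq hs hd hS] at hτ₀
    rcases hτ₀ with rfl | rfl
    · exact Richardson.crossesToRight_scaledChar hp hpq.ne hs hd n
    · exact Richardson.crossesToRight_scaledChar hq hpq.ne' (by rw [add_comm]; exact hs)
        (by rw [mul_comm]; exact hd) n
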